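/- Let $m\ge 1$ be an integer, let $\ell$ be an odd integer, and put $\alpha=1+2^m\ell$, $s=2^{m-1}$, $u=s^2$. Write $[x,y]=x^{-1}y^{-1}xy$ and $x^y=y^{-1}xy$ for group elements $x,y$, and let $$J=\langle A,B\mid A^{[A,B]}=A^\alpha,\ B^{[B,A]}=B^\alpha,\ A^{2^{3m-1}}=1,\ B^{2^{3m-1}}=1\rangle,\qquad C=[A,B].$$ For integers $n,k,t$ define the (integer-valued) functions $$\phi(n)=\frac{(n-1)n}{2},\qquad \varphi(n)=\frac{n(n-1)(n-2)}{6},$$ $$\sigma_1(k,t)=\frac{k\phi(t)(k\phi(t)-1)}{2},\qquad \sigma_2(k,t)=\frac{k\phi(t)(k^2\phi(t)-1)}{6},$$ $$\sigma_3(t)=\frac16\left(\frac{(t-1)t\,(6(t-1)^3+9(t-1)^2+t-2)}{30}-3\phi(t)^2+4\varphi(t)+2\phi(t)\right).$$ Then for all integers $a,b,c,n$ the following identity holds in $J$: $$(A^aB^bC^c)^n=A^{e_A}B^{e_B}C^{e_C}A^{\xi_4},$$ where \begin{align*} e_A&=na+2s\ell\{a^2b\varphi(n)+(\phi(a)b-ac)\phi(n)\},\\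 e_B&=nb+2s\ell\{(b(c-ab)-a\phi(b))\phi(n)-2ab^2\varphi(n)\},\\ e_C&=nc-ab\phi(n)+2s\ell\{a^2\phi(b)\varphi(n)+\phi(a)\phi(b)\phi(n)-a^2b^2\sigma_2(1,n)-(\phi(a)b-ac)b\varphi(n+1)\}, \end{align*} \begin{align*} \xi_4=2u\ell^2\{&a(\varphi(b)+2\phi(b)-2\phi(c))\phi(n)+a^2(3\varphi(b)-2b\phi(b))(2\varphi(n)+\phi(n))\\ &+2a\phi(b)c\varphi(n)-2a^2b\phi(b)(\sigma_1(1,n)-\varphi(n))\\ &+(2bc+7\phi(b))(a^2\varphi(n)+\phi(a)\phi(n))\\ &-2\phi(b)(a+b)(\sigma_1(a,n)-a\varphi(n))-2b\sigma_2(a,n)\\ &+(2\phi(b)-2c-b)(a^2b\sigma_2(1,n)+(\phi(a)b-ac)\varphi(n+1))\\ &+2b(a(\phi(a)b-ac)+b^2(\phi(a)-a^2))(\sigma_1(1,n)+\varphi(n+1))\\ &+2a^2b^2(a-b)(\sigma_3(n)+\sigma_1(1,n)-\varphi(n))\\ &-2c((c-ab)b\varphi(n+1)-2ab^2\sigma_2(1,n))\\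 &+2b(\sigma_1(ab,n)+(\phi(c+1)-abc)\phi(n)-ab(2c+1)\varphi(n))\}. \end{align*} -/

import Mathlib

namespace MacdonaldSylow

/-- The conjugate `x ^ y = y⁻¹ x y`. -/
def conjBy {G : Type*} [Group G] (x y : G) : G := y⁻¹ * x * y

/-- The commutator `[x, y] = x⁻¹ y⁻¹ x y` (this is not Mathlib's `⁅x, y⁆`, which is
`x y x⁻¹ y⁻¹`). -/
def comm {G : Type*} [Group G] (x y : G) : G := x⁻¹ * y⁻¹ * x * y

/-- The relators of `J` on the free generators `x = of 0`, `y = of 1`, expressing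
`x ^ [x, y] = x ^ α`, `y ^ [y, x] = y ^ α`, `x ^ (2 ^ (3 m - 1)) = 1 = y ^ (2 ^ (3 m - 1))`
with `α = 1 + 2 ^ m ℓ`. -/
def relators (m : ℕ) (ℓ : ℤ) : Set (FreeGroup (Fin 2)) :=
  let x : FreeGroup (Fin 2) := FreeGroup.of 0
  let y : FreeGroup (Fin 2) := FreeGroup.of 1
  let α : ℤ := 1 + 2 ^ m * ℓ
  {conjBy x (comm x y) * (x ^ α)⁻¹,
   conjBy y (comm y x) * (y ^ α)⁻¹,
   x ^ (2 ^ (3 * m - 1)),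
   y ^ (2 ^ (3 * m - 1))}

/-- The group `J = ⟨A, B | A ^ [A, B] = A ^ α, B ^ [B, A] = B ^ α,
A ^ (2 ^ (3 m - 1)) = B ^ (2 ^ (3 m - 1)) = 1⟩`, `α = 1 + 2 ^ m ℓ`. -/
abbrev J (m : ℕ) (ℓ : ℤ) : Type := PresentedGroup (relators m ℓ)

/-- The generator `A` of `J`. -/
def A (m : ℕ) (ℓ : ℤ) : J m ℓ := PresentedGroup.of 0

/-- The generator `B` of `J`. -/
def B (m : ℕ) (ℓ : ℤ) : J m ℓ := PresentedGroup.of 1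

/-- The element `C = [A, B]` of `J`. -/
def C (m : ℕ) (ℓ : ℤ) : J m ℓ := comm (A m ℓ) (B m ℓ)

/-- `s = 2 ^ (m - 1)`; it is used for `m ≥ 1` only. -/
def s (m : ℕ) : ℤ := 2 ^ (m - 1)

/-- `u = s ^ 2`. -/
def u (m : ℕ) : ℤ := s m ^ 2

/-! All integer divisions below are exact: see the casts to `ℚ` that follow. -/

/-- `φ(n) = (n - 1) n / 2`. -/
def phi (n : ℤ) : ℤ := (n - 1) * n / 2

/-- The second auxiliary function, `ϕ(n) = n (n - 1) (n - 2) / 6`. -/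
def vphi (n : ℤ) : ℤ := n * (n - 1) * (n - 2) / 6

/-- `σ₁(k, t) = k φ(t) (k φ(t) - 1) / 2`. -/
def sigma1 (k t : ℤ) : ℤ := k * phi t * (k * phi t - 1) / 2

/-- `σ₂(k, t) = k φ(t) (k² φ(t) - 1) / 6`. -/
def sigma2 (k t : ℤ) : ℤ := k * phi t * (k ^ 2 * phi t - 1) / 6

/-- `σ₃(t) = ((t-1) t (6 (t-1)³ + 9 (t-1)² + t - 2) / 30 - 3 φ(t)² + 4 ϕ(t) + 2 φ(t)) / 6`. -/
def sigma3 (t : ℤ) : ℤ :=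
  ((t - 1) * t * (6 * (t - 1) ^ 3 + 9 * (t - 1) ^ 2 + t - 2) / 30
    - 3 * phi t ^ 2 + 4 * vphi t + 2 * phi t) / 6

theorem two_mul_phi (n : ℤ) : 2 * phi n = (n - 1) * n := by
  have h : (2 : ℤ) ∣ (n - 1) * n := by
    have := Int.even_mul_pred_self n
    rw [mul_comm]; exact this.two_dvd
  exact Int.mul_ediv_cancel' h

theorem phi_add_one (n : ℤ) : phi (n + 1) = phi n + n := by
  have h1 := two_mul_phi n
  have h2 := two_mul_phi (n + 1)
  linarith

theorem six_mul_vphi (n : ℤ) : 6 * vphi n = n * (n - 1) * (n - 2) := by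
  have h : (6 : ℤ) ∣ n * (n - 1) * (n - 2) := by
    have h2 : (2 : ℤ) ∣ n * (n - 1) * (n - 2) :=
      (Int.even_mul_pred_self n).two_dvd.mul_right _
    have h3 : (3 : ℤ) ∣ n * (n - 1) * (n - 2) := by
      have : n % 3 = 0 ∨ n % 3 = 1 ∨ n % 3 = 2 := by omega
      rcases this with h | h | h
      · exact ((Int.dvd_of_emod_eq_zero h).mul_right _).mul_right _
      · exact ((show (3 : ℤ) ∣ n - 1 by omega).mul_left _).mul_right _
      · exact (show (3 : ℤ) ∣ n - 2 by omega).mul_left _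
    omega
  exact Int.mul_ediv_cancel' h

theorem vphi_add_one (n : ℤ) : vphi (n + 1) = vphi n + phi n := by
  have h1 := six_mul_vphi n
  have h2 := six_mul_vphi (n + 1)
  have h3 := two_mul_phi n
  linarith

theorem two_mul_sigma1 (k t : ℤ) : 2 * sigma1 k t = k * phi t * (k * phi t - 1) :=
  Int.mul_ediv_cancel' (Int.even_mul_pred_self (k * phi t)).two_dvd

theorem six_mul_sigma2 (k t : ℤ) : 6 * sigma2 k t = k * phi t * (k ^ 2 * phi t - 1) := by
  have h2 : (2 : ℤ) ∣ k * phi t * (k ^ 2 * phi t - 1) := by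
    rcases Int.even_or_odd k with hk | hk
    · exact (hk.two_dvd.mul_right _).mul_right _
    · rcases Int.even_or_odd (phi t) with hp | hp
      · exact (hp.two_dvd.mul_left _).mul_right _
      · exact (((hk.pow).mul hp).sub_odd odd_one).two_dvd.mul_left _
  have h3 : (3 : ℤ) ∣ k * phi t * (k ^ 2 * phi t - 1) := by
    have ht := two_mul_phi t
    have h : t % 3 = 0 ∨ t % 3 = 1 ∨ t % 3 = 2 := by omega
    have hp : phi t % 3 = 0 ∨ phi t % 3 = 1 := by
      rcases h with h | h | h
      · obtain ⟨q, rfl⟩ := Int.dvd_of_emod_eq_zero h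
        left
        have : 2 * phi (3 * q) = 3 * ((3 * q - 1) * q) := by rw [ht]; ring
        omega
      · obtain ⟨q, hq⟩ := show (3 : ℤ) ∣ t - 1 by omega
        left
        have : 2 * phi t = 3 * (q * t) := by rw [ht, hq]; ring
        omega
      · obtain ⟨q, hq⟩ := show (3 : ℤ) ∣ t - 2 by omega
        right
        have : 2 * phi t = 3 * (q * t + q) + 2 := by
          rw [ht, show t = 3 * q + 2 by omega]; ring
        omega
    rcases hp with hp | hp
    · exact ((Int.dvd_of_emod_eq_zero hp).mul_left _).mul_right _
    · obtain ⟨p, hp⟩ := show (3 : ℤ) ∣ phi t - 1 by omega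
      have e : k * phi t * (k ^ 2 * phi t - 1)
          = 3 * (k ^ 3 * p * (phi t + 1) - k * p) + (k - 1) * k * (k + 1) := by
        rw [show phi t = 3 * p + 1 by omega]; ring
      rw [e]
      refine dvd_add (dvd_mul_right _ _) ?_
      have h6 := six_mul_vphi (k + 1)
      exact ⟨2 * vphi (k + 1), by linarith⟩
  have h6 : (6 : ℤ) ∣ k * phi t * (k ^ 2 * phi t - 1) := by omega
  exact Int.mul_ediv_cancel' h6

theorem sigma3_dvd (t : ℤ) :
    (30 : ℤ) ∣ (t - 1) * t * (6 * (t - 1) ^ 3 + 9 * (t - 1) ^ 2 + t - 2) ∧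
    (6 : ℤ) ∣ (t - 1) * t * (6 * (t - 1) ^ 3 + 9 * (t - 1) ^ 2 + t - 2) / 30
      - 3 * phi t ^ 2 + 4 * vphi t + 2 * phi t := by
  let P : ℤ → Prop := fun t =>
    ∃ q : ℤ, (t - 1) * t * (6 * (t - 1) ^ 3 + 9 * (t - 1) ^ 2 + t - 2) = 30 * q ∧
      (6 : ℤ) ∣ q - 3 * phi t ^ 2 + 4 * vphi t + 2 * phi t
  -- Passing from `t` to `t + 1` adds `t ^ 4` to `q` and `6 t ϕ(t)` to the numerator of `σ₃`.
  have key : ∀ t q : ℤ, q + t ^ 4 - 3 * phi (t + 1) ^ 2 + 4 * vphi (t + 1) + 2 * phi (t + 1)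
      = (q - 3 * phi t ^ 2 + 4 * vphi t + 2 * phi t) + 6 * (t * vphi t) := by
    intro t q
    have h1 := two_mul_phi t
    have h2 := six_mul_vphi t
    rw [phi_add_one, vphi_add_one]
    have : 6 * (t * vphi t) = t * (t * (t - 1) * (t - 2)) := by rw [← h2]; ring
    rw [this]
    linear_combination (-3 * t + 2) * h1
  have hup : ∀ t, P t → P (t + 1) := by
    rintro t ⟨q, hq, hd⟩
    refine ⟨q + t ^ 4, by linear_combination hq, ?_⟩
    rw [key]
    exact dvd_add hd (dvd_mul_right _ _)
  have hdown : ∀ t, P (t + 1) → P t := by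
    rintro t ⟨q, hq, hd⟩
    refine ⟨q - t ^ 4, by linear_combination hq, ?_⟩
    have := key t (q - t ^ 4)
    rw [sub_add_cancel] at this
    rw [this] at hd
    exact (dvd_add_left (dvd_mul_right _ _)).mp hd
  have hP : P t := by
    induction t with
    | zero => exact ⟨0, by norm_num, by norm_num [phi, vphi]⟩
    | succ i ih => exact hup _ ih
    | pred i ih => exact hdown _ (by simpa using ih)
  obtain ⟨q, hq, hd⟩ := hP
  refine ⟨⟨q, hq⟩, ?_⟩
  rw [hq, Int.mul_ediv_cancel_left _ (by norm_num)]
  exact hd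

theorem phi_cast (n : ℤ) : (phi n : ℚ) = ((n : ℚ) - 1) * n / 2 := by
  have h : (2 : ℚ) * phi n = ((n : ℚ) - 1) * n := by exact_mod_cast two_mul_phi n
  linarith

theorem vphi_cast (n : ℤ) : (vphi n : ℚ) = (n : ℚ) * (n - 1) * (n - 2) / 6 := by
  have h : (6 : ℚ) * vphi n = (n : ℚ) * (n - 1) * (n - 2) := by
    exact_mod_cast six_mul_vphi n
  linarith

theorem sigma1_cast (k t : ℤ) :
    (sigma1 k t : ℚ) = (k : ℚ) * phi t * (k * phi t - 1) / 2 := by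
  have h : (2 : ℚ) * sigma1 k t = (k : ℚ) * phi t * (k * phi t - 1) := by
    exact_mod_cast two_mul_sigma1 k t
  linarith

theorem sigma2_cast (k t : ℤ) :
    (sigma2 k t : ℚ) = (k : ℚ) * phi t * ((k : ℚ) ^ 2 * phi t - 1) / 6 := by
  have h : (6 : ℚ) * sigma2 k t = (k : ℚ) * phi t * ((k : ℚ) ^ 2 * phi t - 1) := by
    exact_mod_cast six_mul_sigma2 k t
  linarith

theorem sigma3_cast (t : ℤ) :
    (sigma3 t : ℚ) =
      1 / 6 * (((t : ℚ) - 1) * t * (6 * ((t : ℚ) - 1) ^ 3 + 9 * ((t : ℚ) - 1) ^ 2 + t - 2) / 30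
        - 3 * (phi t : ℚ) ^ 2 + 4 * vphi t + 2 * phi t) := by
  obtain ⟨h30, h6⟩ := sigma3_dvd t
  unfold sigma3
  rw [Int.cast_div h6 (by norm_num)]
  push_cast [Int.cast_div h30 (by norm_num : ((30 : ℤ) : ℚ) ≠ 0)]
  ring

/-- The exponent of `A` in the power formula. -/
def expA (m : ℕ) (ℓ a b c n : ℤ) : ℤ :=
  n * a + 2 * s m * ℓ * (a ^ 2 * b * vphi n + (phi a * b - a * c) * phi n)

/-- The exponent of `B` in the power formula. -/
def expB (m : ℕ) (ℓ a b c n : ℤ) : ℤ :=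
  n * b + 2 * s m * ℓ *
    ((b * (c - a * b) - a * phi b) * phi n - 2 * a * b ^ 2 * vphi n)

/-- The exponent of `C` in the power formula. -/
def expC (m : ℕ) (ℓ a b c n : ℤ) : ℤ :=
  n * c - a * b * phi n + 2 * s m * ℓ *
    (a ^ 2 * phi b * vphi n + phi a * phi b * phi n - a ^ 2 * b ^ 2 * sigma2 1 n
      - (phi a * b - a * c) * b * vphi (n + 1))

/-- The exponent `ξ₄` of the central factor `A ^ ξ₄` in the power formula. -/
def xi4 (m : ℕ) (ℓ a b c n : ℤ) : ℤ :=
  2 * u m * ℓ ^ 2 *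
    (a * (vphi b + 2 * phi b - 2 * phi c) * phi n
      + a ^ 2 * (3 * vphi b - 2 * b * phi b) * (2 * vphi n + phi n)
      + 2 * a * phi b * c * vphi n - 2 * a ^ 2 * b * phi b * (sigma1 1 n - vphi n)
      + (2 * b * c + 7 * phi b) * (a ^ 2 * vphi n + phi a * phi n)
      - 2 * phi b * (a + b) * (sigma1 a n - a * vphi n) - 2 * b * sigma2 a n
      + (2 * phi b - 2 * c - b) *
          (a ^ 2 * b * sigma2 1 n + (phi a * b - a * c) * vphi (n + 1))
      + 2 * b * (a * (phi a * b - a * c) + b ^ 2 * (phi a - a ^ 2)) *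
          (sigma1 1 n + vphi (n + 1))
      + 2 * a ^ 2 * b ^ 2 * (a - b) * (sigma3 n + sigma1 1 n - vphi n)
      - 2 * c * ((c - a * b) * b * vphi (n + 1) - 2 * a * b ^ 2 * sigma2 1 n)
      + 2 * b * (sigma1 (a * b) n + (phi (c + 1) - a * b * c) * phi n
          - a * b * (2 * c + 1) * vphi n))

end MacdonaldSylow

namespace MacdonaldSylow

/-! ### Integer powers and truncated binomial expansions. -/

variable {G : Type*} [Group G]

/-! Put `x = 2sℓ = α - 1`. Since `a` and `b` have order dividing `4s³`, which divides `x³`,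
conjugation by `c ^ k` acts on their powers through the binomial expansion of `(1 + x) ^ k` cut off
after `x²`. Evaluating `a ^ (1 + x) * b` in two ways (`fundamental`) makes `z = a ^ (2s²) = b ^
(-2s²)` central (`isSylowTriple`), with `z ^ (2s) = 1` and `c ^ (2s²) = z ^ s`. As `x² = 2s² · 2ℓ²`,
a second-order term in an exponent of `a` or `b` becomes a power of `z`, in an exponent of `c` it
disappears, and a multiple of `x` in an exponent of `z` disappears. Hence each product has a form
`word` whose parameters are polynomial in the exponents, and right multiplication by powers of `a`,
`b`, `c` updates them explicitly (`word_mul_a_zpow`, `word_mul_b_zpow`, `word_mul_c_zpow`). The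
power formula (`mul_zpow`) then follows by induction on `n` in both directions: its exponents vanish
at `0` and satisfy the resulting recursion, a polynomial identity over `ℚ`. -/

theorem zpow_eq_zpow_of_dvd {g : G} {M i j : ℤ} (h : g ^ M = 1) (hd : M ∣ i - j) :
    g ^ i = g ^ j := by
  obtain ⟨t, ht⟩ := hd
  rw [show i = M * t + j by linarith, zpow_add, zpow_mul, h, one_zpow, one_mul]

/-- A function `ℤ → G` with `f 0 = 1` and `f (n + 1) = f n * g` is `n ↦ g ^ n`. -/
theorem zpow_eq_of_step {g : G} {f : ℤ → G} (h0 : f 0 = 1) (hs : ∀ n, f (n + 1) = f n * g)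
    (n : ℤ) : g ^ n = f n := by
  induction n with
  | zero => simp [h0]
  | succ i ih => rw [hs, zpow_add_one, ih]
  | pred i ih =>
    have := hs (-(i : ℤ) - 1)
    rw [sub_add_cancel] at this
    rw [zpow_sub_one, ih, this, mul_inv_cancel_right]

theorem phi_neg (n : ℤ) : phi (-n) = phi (n + 1) := by
  have h1 := two_mul_phi (-n)
  have h2 := two_mul_phi (n + 1)
  linarith

/-- The sum of the squares of the integers `0, …, n - 1`. -/
def sqSum (n : ℤ) : ℤ := 2 * vphi n + phi n

theorem six_mul_sqSum (n : ℤ) : 6 * sqSum n = n * (n - 1) * (2 * n - 1) := by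
  unfold sqSum
  linear_combination 2 * six_mul_vphi n + 3 * two_mul_phi n

theorem sqSum_add_one (n : ℤ) : sqSum (n + 1) = sqSum n + n ^ 2 := by
  have h1 := six_mul_sqSum n
  have h2 := six_mul_sqSum (n + 1)
  linarith

/-- Conjugation by powers of `c` when `c b c⁻¹ = b ^ (1 + x)` and `b ^ x ^ 3 = 1`. -/
theorem semiconjBy_zpow_zpow {c b : G} {x : ℤ} (h : SemiconjBy c b (b ^ (1 + x)))
    (hx : b ^ (x ^ 3) = 1) (k a : ℤ) :
    SemiconjBy (c ^ k) (b ^ a) (b ^ (a * (1 + k * x + phi k * x ^ 2))) := by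
  have hz : ∀ j : ℤ, SemiconjBy c (b ^ j) (b ^ ((1 + x) * j)) := fun j => by
    rw [zpow_mul]; exact h.zpow_right j
  induction k generalizing a with
  | zero => simp [phi]
  | succ i ih =>
    rw [add_comm, zpow_add, zpow_one]
    refine SemiconjBy.mul_left ?_ (ih a)
    -- By Pascal's rule for `phi`, the two exponents differ only by a multiple of `x³`.
    have e : b ^ (a * (1 + (1 + (i : ℤ)) * x + phi (1 + i) * x ^ 2)) =
        b ^ ((1 + x) * (a * (1 + i * x + phi i * x ^ 2))) := by
      refine zpow_eq_zpow_of_dvd hx ⟨-a * phi i, ?_⟩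
      rw [add_comm 1 (i : ℤ), phi_add_one]
      ring
    rw [e]
    exact hz _
  | pred i ih =>
    rw [sub_eq_neg_add, zpow_add, zpow_neg, zpow_one]
    refine SemiconjBy.mul_left ?_ (ih a)
    rw [SemiconjBy.inv_symm_left_iff]
    have e : b ^ (a * (1 + -i * x + phi (-i) * x ^ 2)) =
        b ^ ((1 + x) * (a * (1 + (-1 + -(i : ℤ)) * x + phi (-1 + -i) * x ^ 2))) := by
      have h2 := phi_add_one (-1 + -(i : ℤ))
      rw [neg_add_cancel_comm] at h2
      refine zpow_eq_zpow_of_dvd hx ⟨-a * phi (-1 + -i), ?_⟩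
      rw [h2]
      ring
    rw [e]
    exact hz _

/-! ### Consequences of the Macdonald relations. -/

/-- The relations of the Macdonald group with parameter `1 + x`, for a triple with `c = [a, b]`,
together with `a ^ M = b ^ M = 1` for a divisor `M` of `x ^ 3`. -/
structure IsMacdonaldTriple (x M : ℤ) (a b c : G) : Prop where
  conj_a : SemiconjBy c⁻¹ a (a ^ (1 + x))
  conj_b : SemiconjBy c b (b ^ (1 + x))
  b_mul_a : b * a = a * b * c⁻¹
  a_zpow : a ^ M = 1
  b_zpow : b ^ M = 1
  dvd : M ∣ x ^ 3

namespace IsMacdonaldTriple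

variable {x M : ℤ} {a b c : G}

theorem a_mul_b (h : IsMacdonaldTriple x M a b c) : a * b = b * a * c := by
  rw [h.b_mul_a, inv_mul_cancel_right]

/-- The relations are symmetric because `[b, a] = c⁻¹`; each rule for one generator thus yields one
for the other. -/
theorem swap (h : IsMacdonaldTriple x M a b c) : IsMacdonaldTriple x M b a c⁻¹ where
  conj_a := by rw [inv_inv]; exact h.conj_b
  conj_b := h.conj_a
  b_mul_a := by rw [inv_inv]; exact h.a_mul_b
  a_zpow := h.b_zpow
  b_zpow := h.a_zpow
  dvd := h.dvd

theorem c_mul_b (h : IsMacdonaldTriple x M a b c) (k i : ℤ) :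
    c ^ k * b ^ i = b ^ (i * (1 + k * x + phi k * x ^ 2)) * c ^ k :=
  semiconjBy_zpow_zpow h.conj_b
    ((zpow_eq_zpow_of_dvd h.b_zpow (by simpa using h.dvd)).trans (zpow_zero b)) k i

theorem c_mul_a (h : IsMacdonaldTriple x M a b c) (k i : ℤ) :
    c ^ k * a ^ i = a ^ (i * (1 - k * x + phi (k + 1) * x ^ 2)) * c ^ k := by
  have := h.swap.c_mul_b (-k) i
  rw [inv_zpow', neg_neg, phi_neg] at this
  rw [this]
  ring_nf

theorem a_mul_c_zpow (h : IsMacdonaldTriple x M a b c) (n : ℤ) :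
    (a * c) ^ n = a ^ (n - x * phi n + x ^ 2 * vphi (n + 1)) * c ^ n := by
  refine zpow_eq_of_step (f := fun n => a ^ (n - x * phi n + x ^ 2 * vphi (n + 1)) * c ^ n)
    (by simp [phi, vphi]) (fun n => ?_) n
  have h1 := h.c_mul_a n 1
  rw [zpow_one] at h1
  rw [mul_assoc, ← mul_assoc (c ^ n), h1, mul_assoc, ← zpow_add_one, ← mul_assoc, ← zpow_add,
    vphi_add_one (n + 1), phi_add_one]
  ring_nf

/-- The relation `a * b = b * (a * c)` says that `b` conjugates `a * c` to `a`, so only powers of `a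
* c` are needed. -/
theorem a_zpow_mul_b (h : IsMacdonaldTriple x M a b c) (n : ℤ) :
    a ^ n * b = b * (a ^ (n - x * phi n + x ^ 2 * vphi (n + 1)) * c ^ n) := by
  rw [← h.a_mul_c_zpow]
  have : SemiconjBy b (a * c) a := by
    rw [SemiconjBy, h.a_mul_b, mul_assoc]
  exact (this.zpow_right n).eq.symm

theorem b_mul_a_zpow (h : IsMacdonaldTriple x M a b c) (n : ℤ) :
    b * a ^ n = a ^ n * b * a ^ (x * phi n + x ^ 2 * sqSum n) * c ^ (-n) := by
  have h1 := h.a_zpow_mul_b (-n)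
  have h2 := h.c_mul_a (-n) n
  have h3 : b * a ^ n = a ^ n * (a ^ (-n) * b) * a ^ n := by group
  rw [h3, h1]
  simp only [mul_assoc]
  rw [h2, ← mul_assoc (a ^ _) (a ^ _) (c ^ (-n)), ← zpow_add]
  congr 4
  have e1 := two_mul_phi n
  have e2 := two_mul_phi (-n)
  have e3 := two_mul_phi (-n + 1)
  have e4 := six_mul_vphi n
  have e5 := six_mul_vphi (-n + 1)
  unfold sqSum
  have : (6 : ℤ) ≠ 0 := by norm_num
  apply mul_left_cancel₀ this
  linear_combination (-3 * x - 3 * x ^ 2) * e1 - 3 * x * e2 + 3 * x ^ 2 * n * e3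
    - 2 * x ^ 2 * e4 + x ^ 2 * e5

/-- Since `a ^ (1 + x) = c⁻¹ * a * c`, multiplying `a ^ (1 + x) * b` by `c` on the left gives `a * b
^ (1 + x) * c`. Collecting `a ^ (1 + x) * b` by `a_zpow_mul_b` and `a * b ^ (1 + x)` by the swapped
`b_mul_a_zpow` makes the powers of `c` cancel, leaving a relation between `a` and `b` alone. -/
theorem fundamental (h : IsMacdonaldTriple x M a b c) :
    a * b ^ (x * phi (1 + x) + x ^ 2 * sqSum (1 + x)) =
      a ^ (((1 + x) - x * phi (1 + x) + x ^ 2 * vphi (1 + x + 1)) * (1 - x + x ^ 2)) := by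
  have h1 := h.a_zpow_mul_b (1 + x)
  have h2 := h.swap.b_mul_a_zpow (1 + x)
  have h3 := h.conj_a.eq
  have h4 := h.conj_b.eq
  have h5 := h.c_mul_a 1
    ((1 + x) - x * phi (1 + x) + x ^ 2 * vphi (1 + x + 1))
  rw [show phi (1 + 1) = 1 by rfl, one_mul, one_mul, zpow_one] at h5
  rw [← mul_right_cancel_iff (a := c⁻¹ ^ (-(1 + x))),
    ← mul_right_inj (b ^ (1 + x)), ← mul_assoc, ← mul_assoc, ← h2]
  rw [show a ^ (1 + x) = c⁻¹ * a * c by rw [h3, inv_mul_cancel_right]] at h1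
  have h6 : c * (c⁻¹ * a * c * b) = a * b ^ (1 + x) * c := by
    rw [mul_assoc, mul_assoc, mul_inv_cancel_left, h4, ← mul_assoc]
  rw [h1, ← mul_assoc c, h4] at h6
  have h7 : a * b ^ (1 + x) = b ^ (1 + x) *
      (c * a ^ ((1 + x) - x * phi (1 + x) + x ^ 2 * vphi (1 + x + 1))) *
      c ^ (1 + x) * c⁻¹ := by
    rw [eq_mul_inv_iff_mul_eq, ← h6]
    simp only [mul_assoc]
  rw [h7, h5, inv_zpow', neg_neg]
  simp only [mul_assoc]
  congr 2
  group

end IsMacdonaldTriple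

/-! ### The central element `z`. -/

/-- A Macdonald triple with `x = 2 s ℓ` and `M = 4 s ^ 3`, together with a central element
`z = a ^ (2 s ^ 2)` and the relations that hold between the powers of `a`, `b`, `c`, `z`. -/
structure IsSylowTriple (s ℓ : ℤ) (a b c z : G) : Prop
    extends IsMacdonaldTriple (2 * s * ℓ) (4 * s ^ 3) a b c where
  isCoprime : IsCoprime s 3
  comm_a : Commute z a
  comm_b : Commute z b
  comm_c : Commute z c
  a_zpow_eq : a ^ (2 * s ^ 2) = z
  b_zpow_eq : b ^ (2 * s ^ 2) = z⁻¹
  c_zpow_eq : c ^ (2 * s ^ 2) = z ^ s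
  z_zpow : z ^ (2 * s) = 1

namespace IsMacdonaldTriple

theorem a_zpow_eq_b_zpow {k : ℕ} {s ℓ : ℤ} {a b c : G} (hs : s = 2 ^ k) (hℓ : Odd ℓ)
    (h : IsMacdonaldTriple (2 * s * ℓ) (4 * s ^ 3) a b c) :
    a ^ (2 * s ^ 2) = b ^ (-(2 * s ^ 2)) := by
  have hs3 : IsCoprime s 3 := by
    rw [hs]; exact IsCoprime.pow_left ⟨-1, 1, by norm_num⟩
  have hsℓ : IsCoprime (ℓ ^ 2) (2 * s) := by
    rw [hs, ← pow_succ']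
    refine IsCoprime.pow ?_
    obtain ⟨q, rfl⟩ := hℓ
    exact ⟨1, -q, by ring⟩
  have h1 := h.fundamental
  have e1 := two_mul_phi (1 + 2 * s * ℓ)
  obtain ⟨p, hp⟩ : s ∣ sqSum (1 + 2 * s * ℓ) := by
    refine hs3.dvd_of_dvd_mul_left ⟨ℓ * (1 + 2 * s * ℓ) * (1 + 4 * s * ℓ), ?_⟩
    linarith [six_mul_sqSum (1 + 2 * s * ℓ)]
  obtain ⟨q, hq⟩ : s ∣ vphi (1 + 2 * s * ℓ + 1) := by
    refine hs3.dvd_of_dvd_mul_left ⟨ℓ * (1 + 2 * s * ℓ) * (2 + 2 * s * ℓ), ?_⟩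
    linarith [six_mul_vphi (1 + 2 * s * ℓ + 1)]
  rw [hp, hq] at h1
  -- Modulo `4s³`, `fundamental` reduces to `b ^ (2s²ℓ²) = a ^ (-2s²ℓ²)`, because `x * phi (1 + x) =
  -- x² (1 + x) / 2`.
  rw [zpow_eq_zpow_of_dvd h.b_zpow (j := 2 * s ^ 2 * ℓ ^ 2)
      ⟨ℓ ^ 3 + ℓ ^ 2 * p, by linear_combination s * ℓ * e1⟩,
    zpow_eq_zpow_of_dvd h.a_zpow (j := 1 + -(2 * s ^ 2) * ℓ ^ 2)
      ⟨2 * ℓ ^ 3 + (ℓ ^ 2 * q - ℓ ^ 3) * (1 - 2 * s * ℓ + (2 * s * ℓ) ^ 2) + ℓ ^ 3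
        - 2 * s * ℓ ^ 4,
        by linear_combination -s * ℓ * (1 - 2 * s * ℓ + (2 * s * ℓ) ^ 2) * e1⟩,
    zpow_add, zpow_one, mul_right_inj] at h1
  -- The factor `ℓ²` is invertible modulo `2s`, so raising to the power `-t` removes it.
  obtain ⟨t, v, htv⟩ := hsℓ
  have h2 := congrArg (· ^ (-t)) h1
  simp only [← zpow_mul] at h2
  rw [zpow_eq_zpow_of_dvd h.b_zpow (j := -(2 * s ^ 2))
      ⟨v, by linear_combination -2 * s ^ 2 * htv⟩,
    zpow_eq_zpow_of_dvd h.a_zpow (j := 2 * s ^ 2)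
      ⟨-v, by linear_combination 2 * s ^ 2 * htv⟩] at h2
  exact h2.symm

theorem isSylowTriple {k : ℕ} {s ℓ : ℤ} {a b c : G} (hs : s = 2 ^ k) (hℓ : Odd ℓ)
    (h : IsMacdonaldTriple (2 * s * ℓ) (4 * s ^ 3) a b c) :
    IsSylowTriple s ℓ a b c (a ^ (2 * s ^ 2)) := by
  have hab := h.a_zpow_eq_b_zpow hs hℓ
  have ca : Commute (a ^ (2 * s ^ 2)) a := Commute.zpow_self a _
  have cb : Commute (a ^ (2 * s ^ 2)) b := by rw [hab]; exact Commute.zpow_self b _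
  have hc : c = (b * a)⁻¹ * (a * b) := by rw [h.a_mul_b]; group
  have hs3 : IsCoprime s 3 := by
    rw [hs]; exact IsCoprime.pow_left ⟨-1, 1, by norm_num⟩
  refine ⟨h, hs3, ca, cb, ?_, rfl, ?_, ?_, ?_⟩
  · rw [hc]
    exact (cb.mul_right ca).inv_right.mul_right (ca.mul_right cb)
  · rw [hab, zpow_neg, inv_inv]
  -- As `a ^ (2s²)` commutes with `b`, this rule expresses `c ^ (2s²)` as a power of `a`; its
  -- exponent is `2s³` modulo `4s³` because `ℓ` is odd.
  · have h1 := h.b_mul_a_zpow (2 * s ^ 2)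
    rw [← cb.eq, mul_assoc (_ * b), left_eq_mul, zpow_neg, mul_inv_eq_one] at h1
    rw [← h1, ← zpow_mul]
    obtain ⟨p, hp⟩ : s ∣ sqSum (2 * s ^ 2) := by
      refine hs3.dvd_of_dvd_mul_left ⟨s * (2 * s ^ 2 - 1) * (4 * s ^ 2 - 1), ?_⟩
      linarith [six_mul_sqSum (2 * s ^ 2)]
    obtain ⟨q, hq⟩ := hℓ
    refine zpow_eq_zpow_of_dvd h.a_zpow ⟨s ^ 2 * ℓ + ℓ ^ 2 * p - q - 1, ?_⟩
    rw [hp]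
    linear_combination s * ℓ * two_mul_phi (2 * s ^ 2) - 2 * s ^ 3 * hq
  · rw [← zpow_mul]
    refine (zpow_eq_zpow_of_dvd h.a_zpow ⟨1, ?_⟩).trans (zpow_zero a)
    ring

end IsMacdonaldTriple

/-! ### Collection of words into normal form. -/

/-- The word `a ^ i b ^ (j + x t) c ^ (k + x r) z ^ w`. -/
def word (x : ℤ) (a b c z : G) (i j t k r w : ℤ) : G :=
  a ^ i * b ^ (j + x * t) * c ^ (k + x * r) * z ^ w

namespace IsSylowTriple

variable {s ℓ : ℤ} {a b c z : G}

theorem z_zpow_eq (h : IsSylowTriple s ℓ a b c z) {i j : ℤ} (hd : 2 * s ∣ i - j) :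
    z ^ i = z ^ j :=
  zpow_eq_zpow_of_dvd h.z_zpow hd

theorem a_zpow_add (h : IsSylowTriple s ℓ a b c z) (i t : ℤ) :
    a ^ (i + 2 * s ^ 2 * t) = a ^ i * z ^ t := by
  rw [zpow_add, zpow_mul, h.a_zpow_eq]

theorem b_zpow_add (h : IsSylowTriple s ℓ a b c z) (i t : ℤ) :
    b ^ (i + 2 * s ^ 2 * t) = b ^ i * z ^ (-t) := by
  rw [zpow_add, zpow_mul, h.b_zpow_eq, inv_zpow']

theorem c_zpow_add (h : IsSylowTriple s ℓ a b c z) (i t : ℤ) :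
    c ^ (i + 2 * s ^ 2 * (2 * t)) = c ^ i := by
  rw [zpow_add, zpow_mul, h.c_zpow_eq, ← zpow_mul, h.z_zpow_eq (j := 0) ⟨t, by ring⟩, zpow_zero,
    mul_one]

theorem swap (h : IsSylowTriple s ℓ a b c z) : IsSylowTriple s ℓ b a c⁻¹ z⁻¹ where
  toIsMacdonaldTriple := h.toIsMacdonaldTriple.swap
  isCoprime := h.isCoprime
  comm_a := h.comm_b.inv_left
  comm_b := h.comm_a.inv_left
  comm_c := h.comm_c.inv_inv
  a_zpow_eq := h.b_zpow_eq
  b_zpow_eq := by rw [inv_inv, h.a_zpow_eq]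
  c_zpow_eq := by rw [inv_zpow, inv_zpow, h.c_zpow_eq]
  z_zpow := by rw [inv_zpow, h.z_zpow, inv_one]

theorem z_a (h : IsSylowTriple s ℓ a b c z) (w i : ℤ) : Commute (z ^ w) (a ^ i) :=
  h.comm_a.zpow_zpow w i

theorem z_b (h : IsSylowTriple s ℓ a b c z) (w i : ℤ) : Commute (z ^ w) (b ^ i) :=
  h.comm_b.zpow_zpow w i

theorem z_c (h : IsSylowTriple s ℓ a b c z) (w i : ℤ) : Commute (z ^ w) (c ^ i) :=
  h.comm_c.zpow_zpow w i

/-- Collecting `b ^ v` to the left of `c ^ (k + x r)`. -/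
theorem c_mul_b_zpow (h : IsSylowTriple s ℓ a b c z) (k r v : ℤ) :
    c ^ (k + 2 * s * ℓ * r) * b ^ v = b ^ (v + 2 * s * ℓ * (v * k)) * c ^ (k + 2 * s * ℓ * r) *
      z ^ (-(2 * ℓ ^ 2 * v * r) - ℓ ^ 2 * v * (k * (k - 1))) := by
  rw [h.c_mul_b, mul_assoc (G := G), ← (h.z_c _ _).eq, ← mul_assoc (G := G),
    show v * (1 + (k + 2 * s * ℓ * r) * (2 * s * ℓ) + phi (k + 2 * s * ℓ * r) * (2 * s * ℓ) ^ 2) =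
      v + 2 * s * ℓ * (v * k) + 2 * s ^ 2 * (v * (2 * ℓ ^ 2 * r +
        2 * phi (k + 2 * s * ℓ * r) * ℓ ^ 2)) by ring, h.b_zpow_add]
  congr 2
  refine h.z_zpow_eq ⟨-v * ℓ ^ 3 * r * (2 * k - 1 + 2 * s * ℓ * r), ?_⟩
  linear_combination -v * ℓ ^ 2 * two_mul_phi (k + 2 * s * ℓ * r)

/-- Collecting `a ^ v` to the left of `c ^ (k + x r)`. -/
theorem c_mul_a_zpow (h : IsSylowTriple s ℓ a b c z) (k r v : ℤ) :
    c ^ (k + 2 * s * ℓ * r) * a ^ v = a ^ (v - 2 * s * ℓ * (v * k)) * c ^ (k + 2 * s * ℓ * r) *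
      z ^ (-(2 * ℓ ^ 2 * v * r) + ℓ ^ 2 * v * (k * (k + 1))) := by
  have := h.swap.c_mul_b_zpow (-k) (-r) v
  simp only [inv_zpow'] at this
  ring_nf at this ⊢
  exact this

theorem b_mul_a_zpow' (h : IsSylowTriple s ℓ a b c z) (n : ℤ) :
    b * a ^ n = a ^ n * b * a ^ (2 * s * ℓ * phi n) * c ^ (-n) * z ^ (2 * ℓ ^ 2 * sqSum n) := by
  rw [h.b_mul_a_zpow, show (2 * s * ℓ) ^ 2 * sqSum n = 2 * s ^ 2 * (2 * ℓ ^ 2 * sqSum n) by ring,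
    h.a_zpow_add]
  simp only [mul_assoc (G := G)]
  rw [(h.z_c _ _).eq]

theorem word_mul_b_zpow (h : IsSylowTriple s ℓ a b c z) (i j t k r w v : ℤ) :
    word (2 * s * ℓ) a b c z i j t k r w * b ^ v =
      word (2 * s * ℓ) a b c z i (j + v) (t + v * k) k r
        (w - 2 * ℓ ^ 2 * v * r - ℓ ^ 2 * v * (k * (k - 1))) := by
  have e1 := h.c_mul_b_zpow k r v
  rw [word, word, show w - 2 * ℓ ^ 2 * v * r - ℓ ^ 2 * v * (k * (k - 1)) =
    (-(2 * ℓ ^ 2 * v * r) - ℓ ^ 2 * v * (k * (k - 1))) + w by ring,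
    show j + v + 2 * s * ℓ * (t + v * k) = (j + 2 * s * ℓ * t) + (v + 2 * s * ℓ * (v * k)) by ring,
    mul_assoc (G := G), (h.z_b _ _).eq, ← mul_assoc (G := G), mul_assoc (_ * _) _ (b ^ v), e1,
    zpow_add b (j + 2 * s * ℓ * t), zpow_add z]
  simp only [mul_assoc (G := G)]

theorem word_mul_c_zpow (h : IsSylowTriple s ℓ a b c z) (i j t k r w v q : ℤ) :
    word (2 * s * ℓ) a b c z i j t k r w * c ^ (v + 2 * s * ℓ * q) =
      word (2 * s * ℓ) a b c z i j t (k + v) (r + q) w := by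
  rw [word, word, mul_assoc (G := G), (h.z_c _ _).eq, ← mul_assoc (G := G),
    mul_assoc (_ * _) _ (c ^ _), ← zpow_add]
  ring_nf

theorem word_mul_z_zpow (x : ℤ) (a b c z : G) (i j t k r w v : ℤ) :
    word x a b c z i j t k r w * z ^ v = word x a b c z i j t k r (w + v) := by
  rw [word, word, mul_assoc, ← zpow_add]

theorem word_mul_b_zpow_x (h : IsSylowTriple s ℓ a b c z) (i j t k r w q : ℤ) :
    word (2 * s * ℓ) a b c z i j t k r w * b ^ (2 * s * ℓ * q) =
      word (2 * s * ℓ) a b c z i j (t + q) k r (w - 2 * ℓ ^ 2 * q * k) := by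
  rw [h.word_mul_b_zpow, word, word,
    show j + 2 * s * ℓ * q + 2 * s * ℓ * (t + 2 * s * ℓ * q * k) =
      j + 2 * s * ℓ * (t + q) + 2 * s ^ 2 * (2 * ℓ ^ 2 * q * k) by ring, h.b_zpow_add]
  simp only [mul_assoc (G := G)]
  rw [← mul_assoc (z ^ _), (h.z_c _ _).eq]
  simp only [mul_assoc (G := G)]
  rw [← zpow_add]
  congr 3
  exact h.z_zpow_eq ⟨-2 * ℓ ^ 3 * q * r - ℓ ^ 3 * q * (k * (k - 1)), by ring⟩

/-- Collecting powers of `a ^ x` to the left of powers of `b`. -/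
theorem b_zpow_mul_a_zpow_x (h : IsSylowTriple s ℓ a b c z) (q v : ℤ) :
    b ^ v * a ^ (2 * s * ℓ * q) = a ^ (2 * s * ℓ * q) * b ^ v * c ^ (2 * s * ℓ * -(q * v)) *
      z ^ (ℓ ^ 2 * q * (v * (v - 2))) := by
  have h1 : b * a ^ (2 * s * ℓ * q) =
      a ^ (2 * s * ℓ * q) * (b * c ^ (2 * s * ℓ * -q) * z ^ (-(ℓ ^ 2 * q))) := by
    obtain ⟨p, hp⟩ : s ∣ sqSum (2 * s * ℓ * q) := by
      refine h.isCoprime.dvd_of_dvd_mul_left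
        ⟨ℓ * q * (2 * s * ℓ * q - 1) * (4 * s * ℓ * q - 1), ?_⟩
      linarith [six_mul_sqSum (2 * s * ℓ * q)]
    rw [h.b_mul_a_zpow', show 2 * s * ℓ * phi (2 * s * ℓ * q) =
        0 + 2 * s ^ 2 * (ℓ ^ 2 * q * (2 * s * ℓ * q - 1)) by
          linear_combination s * ℓ * two_mul_phi (2 * s * ℓ * q),
      h.a_zpow_add, zpow_zero, one_mul, mul_assoc (G := G) (_ * b), (h.z_c _ _).eq]
    simp only [mul_assoc (G := G)]
    rw [← zpow_add, mul_neg, h.z_zpow_eq (j := -(ℓ ^ 2 * q)) ⟨ℓ ^ 3 * q ^ 2 + ℓ ^ 2 * p, ?_⟩]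
    rw [hp]
    ring
  -- The bracketed element is the conjugate of `b` by `a ^ (xq)`, so it suffices to compute its
  -- `v`-th power.
  have h2 : SemiconjBy (a ^ (2 * s * ℓ * q)) (b * c ^ (2 * s * ℓ * -q) * z ^ (-(ℓ ^ 2 * q))) b :=
    h1.symm
  have h3 := zpow_eq_of_step (g := b * c ^ (2 * s * ℓ * -q) * z ^ (-(ℓ ^ 2 * q)))
    (f := fun v => word (2 * s * ℓ) a b c z 0 v 0 0 (-(q * v)) (ℓ ^ 2 * q * (v * (v - 2))))
    (by simp [word]) (fun v => ?_) v
  · rw [← (h2.zpow_right v).eq, h3, word]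
    simp [mul_assoc (G := G)]
  · have e1 := h.word_mul_b_zpow 0 v 0 0 (-(q * v)) (ℓ ^ 2 * q * (v * (v - 2))) 1
    have e2 := fun i j t k r w => h.word_mul_c_zpow i j t k r w 0 (-q)
    rw [zpow_one] at e1
    simp only [zero_add] at e2
    rw [← mul_assoc (G := G), ← mul_assoc (G := G), e1, e2, word_mul_z_zpow]
    ring_nf

theorem word_mul_a_zpow_x (h : IsSylowTriple s ℓ a b c z) (i j t k r w q : ℤ) :
    word (2 * s * ℓ) a b c z i j t k r w * a ^ (2 * s * ℓ * q) =
      word (2 * s * ℓ) a b c z (i + 2 * s * ℓ * q) j t k (r - q * j)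
        (w - 2 * ℓ ^ 2 * q * k + ℓ ^ 2 * q * (j * (j - 2))) := by
  have e1 : c ^ (k + 2 * s * ℓ * r) * a ^ (2 * s * ℓ * q) =
      a ^ (2 * s * ℓ * q) * c ^ (k + 2 * s * ℓ * r) * z ^ (-(2 * ℓ ^ 2 * q * k)) := by
    rw [h.c_mul_a_zpow, show 2 * s * ℓ * q - 2 * s * ℓ * (2 * s * ℓ * q * k) =
      2 * s * ℓ * q + 2 * s ^ 2 * (-(2 * ℓ ^ 2 * q * k)) by ring, h.a_zpow_add,
      mul_assoc (a ^ _), (h.z_c _ _).eq, ← mul_assoc (a ^ _), mul_assoc (_ * _), ← zpow_add]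
    congr 1
    exact h.z_zpow_eq ⟨-2 * ℓ ^ 3 * q * r + ℓ ^ 3 * q * (k * (k + 1)), by ring⟩
  have e2 : b ^ (j + 2 * s * ℓ * t) * a ^ (2 * s * ℓ * q) =
      a ^ (2 * s * ℓ * q) * b ^ (j + 2 * s * ℓ * t) * c ^ (2 * s * ℓ * -(q * j)) *
        z ^ (ℓ ^ 2 * q * (j * (j - 2))) := by
    rw [h.b_zpow_mul_a_zpow_x, show 2 * s * ℓ * -(q * (j + 2 * s * ℓ * t)) =
      2 * s * ℓ * -(q * j) + 2 * s ^ 2 * (2 * (-ℓ ^ 2 * q * t)) by ring, h.c_zpow_add]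
    congr 1
    exact h.z_zpow_eq ⟨ℓ ^ 3 * q * t * (2 * j - 2 + 2 * s * ℓ * t), by ring⟩
  have e3 : c ^ (k + 2 * s * ℓ * (r - q * j)) =
      c ^ (2 * s * ℓ * -(q * j)) * c ^ (k + 2 * s * ℓ * r) := by
    rw [← zpow_add]
    ring_nf
  have e4 : z ^ (w - 2 * ℓ ^ 2 * q * k + ℓ ^ 2 * q * (j * (j - 2))) =
      z ^ (ℓ ^ 2 * q * (j * (j - 2))) * z ^ (-(2 * ℓ ^ 2 * q * k)) * z ^ w := by
    rw [← zpow_add, ← zpow_add]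
    ring_nf
  rw [word, word, e3, e4, mul_assoc (G := G), (h.z_a _ _).eq, ← mul_assoc (G := G),
    mul_assoc (_ * _) _ (a ^ _), e1, ← mul_assoc (_ * _), ← mul_assoc (_ * _),
    mul_assoc (a ^ i) (b ^ _) (a ^ _), e2, zpow_add a]
  simp only [mul_assoc (G := G)]
  rw [← mul_assoc (z ^ (ℓ ^ 2 * q * (j * (j - 2)))) (c ^ _), (h.z_c _ _).eq]
  simp only [mul_assoc (G := G)]

/-- Collecting a power of `a` to the left of a power of `b`. -/
theorem b_zpow_mul_a_zpow (h : IsSylowTriple s ℓ a b c z) (i n j : ℤ) :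
    a ^ i * b ^ j * a ^ n = word (2 * s * ℓ) a b c z (i + n + 2 * s * ℓ * (phi n * j)) j
      (-(n * phi j)) (-(n * j)) (-(phi n * phi (j + 1)))
      (ℓ ^ 2 * (2 * sqSum n * j + phi n * (2 * sqSum j + phi j - j) + 2 * n * phi n * phi j
        - n ^ 2 * sqSum j - n * phi j)) := by
  have h1 : SemiconjBy (a ^ n)
      (b * a ^ (2 * s * ℓ * phi n) * c ^ (-n) * z ^ (2 * ℓ ^ 2 * sqSum n)) b := by
    rw [SemiconjBy, h.b_mul_a_zpow' n]
    simp only [mul_assoc (G := G)]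
  have h2 := zpow_eq_of_step (g := b * a ^ (2 * s * ℓ * phi n) * c ^ (-n) * z ^ (2 * ℓ ^ 2 * sqSum n))
    (f := fun j => word (2 * s * ℓ) a b c z (2 * s * ℓ * (phi n * j)) j
      (-(n * phi j)) (-(n * j)) (-(phi n * phi (j + 1)))
      (ℓ ^ 2 * (2 * sqSum n * j + phi n * (2 * sqSum j + phi j - j) + 2 * n * phi n * phi j
        - n ^ 2 * sqSum j - n * phi j)))
    (by simp [word, phi, sqSum, vphi]) (fun j => ?_) j
  · rw [mul_assoc (G := G), ← (h1.zpow_right j).eq, h2, word, word, zpow_add a (i + n),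
      zpow_add a i]
    simp only [mul_assoc (G := G)]
  · have e1 := fun i j t k r w => h.word_mul_b_zpow i j t k r w 1
    have e2 := fun i j t k r w => h.word_mul_c_zpow i j t k r w (-n) 0
    simp only [zpow_one] at e1
    simp only [mul_zero, add_zero] at e2
    simp only [← mul_assoc (G := G)]
    rw [e1, h.word_mul_a_zpow_x, e2, word_mul_z_zpow, phi_add_one (j + 1), sqSum_add_one,
      phi_add_one j]
    have e3 := two_mul_phi j
    congr 1
    · ring
    · ring
    · ring
    · ring
    · linear_combination (-ℓ ^ 2 * phi n) * e3

end IsSylowTriple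

/-! ### The closed formula for `n`-th powers. -/

/-- The factor of `xi4` that does not depend on `m` and `ℓ`. -/
def xiCoeff (a b c n : ℤ) : ℤ :=
  a * (vphi b + 2 * phi b - 2 * phi c) * phi n
      + a ^ 2 * (3 * vphi b - 2 * b * phi b) * (2 * vphi n + phi n)
      + 2 * a * phi b * c * vphi n - 2 * a ^ 2 * b * phi b * (sigma1 1 n - vphi n)
      + (2 * b * c + 7 * phi b) * (a ^ 2 * vphi n + phi a * phi n)
      - 2 * phi b * (a + b) * (sigma1 a n - a * vphi n) - 2 * b * sigma2 a n
      + (2 * phi b - 2 * c - b) *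
          (a ^ 2 * b * sigma2 1 n + (phi a * b - a * c) * vphi (n + 1))
      + 2 * b * (a * (phi a * b - a * c) + b ^ 2 * (phi a - a ^ 2)) *
          (sigma1 1 n + vphi (n + 1))
      + 2 * a ^ 2 * b ^ 2 * (a - b) * (sigma3 n + sigma1 1 n - vphi n)
      - 2 * c * ((c - a * b) * b * vphi (n + 1) - 2 * a * b ^ 2 * sigma2 1 n)
      + 2 * b * (sigma1 (a * b) n + (phi (c + 1) - a * b * c) * phi n
          - a * b * (2 * c + 1) * vphi n)

namespace IsSylowTriple

variable {s ℓ : ℤ} {a b c z : G}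

theorem word_mul_a_zpow (h : IsSylowTriple s ℓ a b c z) (i j t k r w v : ℤ) :
    word (2 * s * ℓ) a b c z i j t k r w * a ^ v =
      word (2 * s * ℓ) a b c z (i + v + 2 * s * ℓ * (phi v * j - v * k)) j (t - v * phi j)
        (k - v * j) (r - phi v * phi (j + 1) - t * v + v * k * j)
        (w + ℓ ^ 2 * (2 * sqSum v * j + phi v * (2 * sqSum j + phi j - j) + 2 * v * phi v * phi j
          - v ^ 2 * sqSum j - v * phi j + 2 * t * v * j - 2 * v ^ 2 * k * j - v * k * (j * (j - 2))
          + t * v * (v - 2) - 2 * v * r + v * k * (k + 1))) := by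
  have e1 := h.c_mul_a_zpow k r v
  have e2 : b ^ (2 * s * ℓ * t) * a ^ v = a ^ v * b ^ (2 * s * ℓ * t) *
      -- The swapped rule moves `b ^ (xt)` leftwards past `a ^ v`; its corrections in `c` and `z`
      -- are then cancelled on the right.
      c ^ (2 * s * ℓ * -(t * v)) * z ^ (ℓ ^ 2 * t * (v * (v - 2))) := by
    rw [h.swap.b_zpow_mul_a_zpow_x t v, inv_zpow', inv_zpow', mul_assoc _ (z ^ _) (c ^ _),
      (h.z_c _ _).eq]
    simp only [mul_assoc (G := G)]
    rw [← zpow_add, neg_add_cancel, zpow_zero, mul_one, ← zpow_add, neg_add_cancel,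
      zpow_zero, mul_one]
  have e3 : a ^ (v - 2 * s * ℓ * (v * k)) = a ^ v * a ^ (2 * s * ℓ * -(v * k)) := by
    rw [← zpow_add]
    ring_nf
  have e4 := fun i j t k r w q => h.word_mul_c_zpow i j t k r w 0 q
  simp only [zero_add] at e4
  have e5 : word (2 * s * ℓ) a b c z i j t k r w * a ^ v =
      a ^ i * b ^ j * a ^ v * b ^ (2 * s * ℓ * t) * c ^ (2 * s * ℓ * -(t * v)) *
        a ^ (2 * s * ℓ * -(v * k)) * c ^ (k + 2 * s * ℓ * r) *
        z ^ (ℓ ^ 2 * t * (v * (v - 2)) +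
          (-(2 * ℓ ^ 2 * v * r) + ℓ ^ 2 * v * (k * (k + 1))) + w) := by
    rw [word, mul_assoc (G := G), (h.z_a _ _).eq, ← mul_assoc (G := G),
      mul_assoc (_ * _) _ (a ^ _), e1, e3, zpow_add b]
    rw [show a ^ i * (b ^ j * b ^ (2 * s * ℓ * t)) * (a ^ v * a ^ (2 * s * ℓ * -(v * k)) *
        c ^ (k + 2 * s * ℓ * r) * z ^ (-(2 * ℓ ^ 2 * v * r) + ℓ ^ 2 * v * (k * (k + 1)))) =
      a ^ i * b ^ j * (b ^ (2 * s * ℓ * t) * a ^ v) * (a ^ (2 * s * ℓ * -(v * k)) *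
        c ^ (k + 2 * s * ℓ * r) * z ^ (-(2 * ℓ ^ 2 * v * r) + ℓ ^ 2 * v * (k * (k + 1)))) by
      simp only [mul_assoc (G := G)], e2, zpow_add z _ w, zpow_add z (ℓ ^ 2 * t * (v * (v - 2)))]
    simp only [mul_assoc (G := G)]
    rw [← mul_assoc (z ^ (ℓ ^ 2 * t * (v * (v - 2)))) (a ^ _), (h.z_a _ _).eq, mul_assoc (a ^ _),
      ← mul_assoc (z ^ (ℓ ^ 2 * t * (v * (v - 2)))) (c ^ _), (h.z_c _ _).eq]
    simp only [mul_assoc (G := G)]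
  rw [e5, h.b_zpow_mul_a_zpow, h.word_mul_b_zpow_x, e4, h.word_mul_a_zpow_x, h.word_mul_c_zpow,
    word_mul_z_zpow]
  congr 1 <;> ring

theorem mul_zpow (h : IsSylowTriple s ℓ a b c z) (p q r n : ℤ) :
    (a ^ p * b ^ q * c ^ r) ^ n = word (2 * s * ℓ) a b c z
      (n * p + 2 * s * ℓ * (p ^ 2 * q * vphi n + (phi p * q - p * r) * phi n))
      (n * q) ((q * (r - p * q) - p * phi q) * phi n - 2 * p * q ^ 2 * vphi n)
      (n * r - p * q * phi n)
      (p ^ 2 * phi q * vphi n + phi p * phi q * phi n - p ^ 2 * q ^ 2 * sigma2 1 n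
        - (phi p * q - p * r) * q * vphi (n + 1))
      (ℓ ^ 2 * xiCoeff p q r n) := by
  refine zpow_eq_of_step (f := fun n => word (2 * s * ℓ) a b c z
      (n * p + 2 * s * ℓ * (p ^ 2 * q * vphi n + (phi p * q - p * r) * phi n))
      (n * q) ((q * (r - p * q) - p * phi q) * phi n - 2 * p * q ^ 2 * vphi n)
      (n * r - p * q * phi n)
      (p ^ 2 * phi q * vphi n + phi p * phi q * phi n - p ^ 2 * q ^ 2 * sigma2 1 n
        - (phi p * q - p * r) * q * vphi (n + 1))
      (ℓ ^ 2 * xiCoeff p q r n))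
    (by simp [word, xiCoeff, phi, vphi, sigma1, sigma2, sigma3]) (fun n => ?_) n
  have e1 := fun i j t k r' w => h.word_mul_c_zpow i j t k r' w r 0
  simp only [mul_zero, add_zero] at e1
  rw [← mul_assoc (G := G), ← mul_assoc (G := G), h.word_mul_a_zpow, h.word_mul_b_zpow, e1]
  congr 1
  -- All divisions in the auxiliary functions are exact, so the recursion can be checked as a
  -- polynomial identity over `ℚ`.
  · rw [← Int.cast_inj (α := ℚ)]
    push_cast [xiCoeff, phi_cast, vphi_cast, sqSum, sigma1_cast, sigma2_cast, sigma3_cast]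
    ring
  · ring
  · rw [← Int.cast_inj (α := ℚ)]
    push_cast [xiCoeff, phi_cast, vphi_cast, sqSum, sigma1_cast, sigma2_cast, sigma3_cast]
    ring
  · rw [← Int.cast_inj (α := ℚ)]
    push_cast [xiCoeff, phi_cast, vphi_cast, sqSum, sigma1_cast, sigma2_cast, sigma3_cast]
    ring
  · rw [← Int.cast_inj (α := ℚ)]
    push_cast [xiCoeff, phi_cast, vphi_cast, sqSum, sigma1_cast, sigma2_cast, sigma3_cast]
    ring
  · rw [← Int.cast_inj (α := ℚ)]
    push_cast [xiCoeff, phi_cast, vphi_cast, sqSum, sigma1_cast, sigma2_cast, sigma3_cast]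
    ring

end IsSylowTriple

/-! ### Application to the presented group `J`. -/

theorem A_pow (m : ℕ) (ℓ : ℤ) : A m ℓ ^ (2 ^ (3 * m - 1)) = 1 := by
  have h : FreeGroup.of 0 ^ (2 ^ (3 * m - 1)) ∈ relators m ℓ := by simp [relators]
  simpa [A, PresentedGroup.of] using PresentedGroup.one_of_mem h

theorem B_pow (m : ℕ) (ℓ : ℤ) : B m ℓ ^ (2 ^ (3 * m - 1)) = 1 := by
  have h : FreeGroup.of 1 ^ (2 ^ (3 * m - 1)) ∈ relators m ℓ := by simp [relators]
  simpa [B, PresentedGroup.of] using PresentedGroup.one_of_mem h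

theorem conjBy_A (m : ℕ) (ℓ : ℤ) :
    conjBy (A m ℓ) (comm (A m ℓ) (B m ℓ)) = A m ℓ ^ (1 + 2 ^ m * ℓ) := by
  have h : conjBy (FreeGroup.of 0) (comm (FreeGroup.of 0) (FreeGroup.of 1)) *
      (FreeGroup.of 0 ^ (1 + 2 ^ m * ℓ))⁻¹ ∈ relators m ℓ := by simp [relators]
  rw [← mul_inv_eq_one]
  simpa [A, B, PresentedGroup.of, conjBy, comm] using PresentedGroup.one_of_mem h

theorem conjBy_B (m : ℕ) (ℓ : ℤ) :
    conjBy (B m ℓ) (comm (B m ℓ) (A m ℓ)) = B m ℓ ^ (1 + 2 ^ m * ℓ) := by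
  have h : conjBy (FreeGroup.of 1) (comm (FreeGroup.of 1) (FreeGroup.of 0)) *
      (FreeGroup.of 1 ^ (1 + 2 ^ m * ℓ))⁻¹ ∈ relators m ℓ := by simp [relators]
  rw [← mul_inv_eq_one]
  simpa [A, B, PresentedGroup.of, conjBy, comm] using PresentedGroup.one_of_mem h

theorem two_mul_s {m : ℕ} (hm : 1 ≤ m) : 2 * s m = 2 ^ m := by
  rw [s, ← pow_succ', Nat.sub_add_cancel hm]

theorem four_mul_s_cubed {m : ℕ} (hm : 1 ≤ m) : 4 * s m ^ 3 = 2 ^ (3 * m - 1) := by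
  obtain ⟨k, rfl⟩ := Nat.exists_eq_add_of_le' hm
  rw [s, show 3 * (k + 1) - 1 = k * 3 + 2 by lia, Nat.add_sub_cancel, pow_add, pow_mul]
  ring

theorem isMacdonaldTriple {m : ℕ} (hm : 1 ≤ m) (ℓ : ℤ) :
    IsMacdonaldTriple (2 * s m * ℓ) (4 * s m ^ 3) (A m ℓ) (B m ℓ) (C m ℓ) where
  conj_a := by
    rw [two_mul_s hm, ← conjBy_A, SemiconjBy, conjBy, C]
    group
  conj_b := by
    rw [two_mul_s hm, ← conjBy_B, SemiconjBy, conjBy, C, comm, comm]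
    group
  b_mul_a := by
    rw [C, comm]
    group
  a_zpow := by
    rw [four_mul_s_cubed hm]
    exact_mod_cast A_pow m ℓ
  b_zpow := by
    rw [four_mul_s_cubed hm]
    exact_mod_cast B_pow m ℓ
  dvd := ⟨2 * ℓ ^ 3, by ring⟩

end MacdonaldSylow

theorem mainTheorem6 (m : ℕ) (hm : 1 ≤ m) (ℓ : ℤ) (hℓ : Odd ℓ) (a b c n : ℤ) :
    (MacdonaldSylow.A m ℓ ^ a * MacdonaldSylow.B m ℓ ^ b * MacdonaldSylow.C m ℓ ^ c) ^ n =
      MacdonaldSylow.A m ℓ ^ MacdonaldSylow.expA m ℓ a b c n *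
      MacdonaldSylow.B m ℓ ^ MacdonaldSylow.expB m ℓ a b c n *
      MacdonaldSylow.C m ℓ ^ MacdonaldSylow.expC m ℓ a b c n *
      MacdonaldSylow.A m ℓ ^ MacdonaldSylow.xi4 m ℓ a b c n := by
  have h := (MacdonaldSylow.isMacdonaldTriple hm ℓ).isSylowTriple
    (rfl : MacdonaldSylow.s m = 2 ^ (m - 1)) hℓ
  -- Writing `z` as `A ^ (2s²)` turns its exponent `ℓ² * xiCoeff` into `xi4`, since `u = s²`.
  rw [h.mul_zpow, MacdonaldSylow.word, ← zpow_mul, ← mul_assoc (2 * MacdonaldSylow.s m ^ 2)]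
  rfl
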